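/- Let $A$ be a Banach algebra (real or complex, not necessarily unital). A Banach $A$-bimodule is a Banach space $X$ with commuting associative left and right actions of $A$ that are bounded bilinear maps; its dual $X^*$ is a Banach $A$-bimodule via $(a\cdot f)(x)=f(x\cdot a)$ and $(f\cdot a)(x)=f(a\cdot x)$. A derivation $D:A\to X$ is a linear map with $D(ab)=a\cdot D(b)+D(a)\cdot b$ for all $a,b\in A$; it is inner if there is $\xi\in X$ with $D(a)=a\cdot\xi-\xi\cdot a$ for all $a\in A$. A linear map $T:A\to X$ is semi-inner if there are $\xi,\eta\in X$ with $T(a)=a\cdot\xi-\eta\cdot a$ for all $a\in A$. (1) Suppose that $A$ is uniformly approximately semi-amenable, that is, for every Banach $A$-bimodule $X$, every continuous derivation $D:A\to X^*$ is a limit, in the operator norm, of semi-inner maps $A\to X^*$. Then $A$ is amenable, that is, for every Banach $A$-bimodule $X$, every continuous derivation $D:A\to X^*$ is inner. (2) Suppose that $A$ is uniformly approximately semi-contractible, that is, for every Banach $A$-bimodule $X$, every continuous derivation $D:A\to X$ is a limit, in the operator norm, of semi-inner maps $A\to X$. Then $A$ is contractible, that is, for every Banach $A$-bimodule $X$, every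 continuous derivation $D:A\to X$ is inner. -/

import Mathlib

universe u

/-- A Banach `A`-bimodule structure on a Banach space `X` over `𝕜`: a left and a right action of the
(not necessarily unital) Banach algebra `A`, given by bounded bilinear maps, which are associative
and commute with each other. Here `lsmul a x` is `a · x` and `rsmul a x` is `x · a`. -/
structure BanachBimodule (𝕜 A X : Type*) [RCLike 𝕜] [NonUnitalNormedRing A] [NormedSpace 𝕜 A]
    [NormedAddCommGroup X] [NormedSpace 𝕜 X] where
  /-- the left action `a · x` -/
  lsmul : A →L[𝕜] X →L[𝕜] X
  /-- the right action `x · a` -/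
  rsmul : A →L[𝕜] X →L[𝕜] X
  lsmul_mul : ∀ (a b : A) (x : X), lsmul (a * b) x = lsmul a (lsmul b x)
  rsmul_mul : ∀ (a b : A) (x : X), rsmul (a * b) x = rsmul b (rsmul a x)
  lsmul_rsmul : ∀ (a b : A) (x : X), rsmul b (lsmul a x) = lsmul a (rsmul b x)

namespace BanachBimodule

section

variable {𝕜 A X : Type*} [RCLike 𝕜] [NonUnitalNormedRing A] [NormedSpace 𝕜 A]
  [NormedAddCommGroup X] [NormedSpace 𝕜 X]

/-- The dual bimodule `X*`, with `(a · f)(x) = f (x · a)` and `(f · a)(x) = f (a · x)`. -/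
noncomputable def dual (M : BanachBimodule 𝕜 A X) : BanachBimodule 𝕜 A (X →L[𝕜] 𝕜) where
  lsmul := (ContinuousLinearMap.compL 𝕜 X X 𝕜).flip.comp M.rsmul
  rsmul := (ContinuousLinearMap.compL 𝕜 X X 𝕜).flip.comp M.lsmul
  lsmul_mul a b f := by ext x; simp [M.rsmul_mul]
  rsmul_mul a b f := by ext x; simp [M.lsmul_mul]
  lsmul_rsmul a b f := by ext x; simp [M.lsmul_rsmul]

theorem dual_lsmul_apply (M : BanachBimodule 𝕜 A X) (a : A) (f : X →L[𝕜] 𝕜) (x : X) :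
    M.dual.lsmul a f x = f (M.rsmul a x) := rfl

theorem dual_rsmul_apply (M : BanachBimodule 𝕜 A X) (a : A) (f : X →L[𝕜] 𝕜) (x : X) :
    M.dual.rsmul a f x = f (M.lsmul a x) := rfl

/-- A continuous linear map `D : A → X` is a derivation if `D (ab) = a · D b + D a · b`. -/
def IsDerivation (M : BanachBimodule 𝕜 A X) (D : A →L[𝕜] X) : Prop :=
  ∀ a b : A, D (a * b) = M.lsmul a (D b) + M.rsmul b (D a)

/-- `D` is inner: `D a = a · ξ - ξ · a` for some `ξ`. -/
def IsInner (M : BanachBimodule 𝕜 A X) (D : A →L[𝕜] X) : Prop :=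
  ∃ ξ : X, ∀ a : A, D a = M.lsmul a ξ - M.rsmul a ξ

/-- `D` is semi-inner: `D a = a · ξ - η · a` for some `ξ` and `η`. A semi-inner map need not be a
derivation. -/
def IsSemiInner (M : BanachBimodule 𝕜 A X) (D : A →L[𝕜] X) : Prop :=
  ∃ ξ η : X, ∀ a : A, D a = M.lsmul a ξ - M.rsmul a η

/-- `D` is a limit of semi-inner maps in the operator norm. -/
def IsNormApproxSemiInner (M : BanachBimodule 𝕜 A X) (D : A →L[𝕜] X) : Prop :=
  D ∈ closure {T : A →L[𝕜] X | M.IsSemiInner T}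

end

end BanachBimodule

section

variable (𝕜 : Type) (A : Type u) [RCLike 𝕜] [NonUnitalNormedRing A] [NormedSpace 𝕜 A]

/-- Every continuous derivation from `A` into the dual of a Banach `A`-bimodule is inner. -/
def IsAmenableBanachAlgebra : Prop :=
  ∀ (X : Type u) [NormedAddCommGroup X] [NormedSpace 𝕜 X] [CompleteSpace X]
    (M : BanachBimodule 𝕜 A X) (D : A →L[𝕜] (X →L[𝕜] 𝕜)),
    M.dual.IsDerivation D → M.dual.IsInner D

/-- Every continuous derivation from `A` into a Banach `A`-bimodule is inner. -/
def IsContractibleBanachAlgebra : Prop :=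
  ∀ (X : Type u) [NormedAddCommGroup X] [NormedSpace 𝕜 X] [CompleteSpace X]
    (M : BanachBimodule 𝕜 A X) (D : A →L[𝕜] X),
    M.IsDerivation D → M.IsInner D

/-- Every continuous derivation from `A` into the dual of a Banach `A`-bimodule is a norm limit of
semi-inner maps. -/
def IsUniformlyApproxSemiAmenable : Prop :=
  ∀ (X : Type u) [NormedAddCommGroup X] [NormedSpace 𝕜 X] [CompleteSpace X]
    (M : BanachBimodule 𝕜 A X) (D : A →L[𝕜] (X →L[𝕜] 𝕜)),
    M.dual.IsDerivation D → M.dual.IsNormApproxSemiInner D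

/-- Every continuous derivation from `A` into a Banach `A`-bimodule is a norm limit of semi-inner
maps. -/
def IsUniformlyApproxSemiContractible : Prop :=
  ∀ (X : Type u) [NormedAddCommGroup X] [NormedSpace 𝕜 X] [CompleteSpace X]
    (M : BanachBimodule 𝕜 A X) (D : A →L[𝕜] X),
    M.IsDerivation D → M.IsNormApproxSemiInner D

end

/-! Approximating the universal derivation `a ↦ (D ↦ D a)` by one semi-inner map treats all
derivations `D` at once: `ξ` and `η` become bounded linear in `D`, with error at most `ε‖D‖`. The
defect from the derivation identity shows that `b · (η - ξ) · a` is small. A right identity `e`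
turns this into smallness of `e · (η - ξ) · a`, so `η - e · (η - ξ)` implements `D` up to a small
error. Thus `inner ∘ R` is near the identity on derivations, hence invertible, and `inner` is
surjective. The right identity comes from the identity map of `A`, a derivation when the right
action is zero. In the amenable case it lies only in `A**`, which still acts on dual modules;
operators into `X*` are reached by projecting from their bidual. -/

set_option maxSynthPendingDepth 3

namespace BanachBimodule

/-! ### From the universal derivation to inner derivations -/

section

variable {𝕜 A X : Type*} [RCLike 𝕜] [NonUnitalNormedRing A] [NormedSpace 𝕜 A]
  [NormedAddCommGroup X] [NormedSpace 𝕜 X]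

/-- The bimodule of bounded operators `Z → X`, with both actions on the values. -/
noncomputable def hom (M : BanachBimodule 𝕜 A X) (Z : Type*) [NormedAddCommGroup Z]
    [NormedSpace 𝕜 Z] : BanachBimodule 𝕜 A (Z →L[𝕜] X) where
  lsmul := (ContinuousLinearMap.compL 𝕜 Z X X).comp M.lsmul
  rsmul := (ContinuousLinearMap.compL 𝕜 Z X X).comp M.rsmul
  lsmul_mul a b f := by ext x; simp [M.lsmul_mul]
  rsmul_mul a b f := by ext x; simp [M.rsmul_mul]
  lsmul_rsmul a b f := by ext x; simp [M.lsmul_rsmul]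

/-- The continuous derivations into a bimodule, as a subspace of the bounded operators. -/
def derivations (M : BanachBimodule 𝕜 A X) : Submodule 𝕜 (A →L[𝕜] X) where
  carrier := {D | M.IsDerivation D}
  add_mem' {D E} hD hE a b := by
    have h₁ := hD a b
    have h₂ := hE a b
    simp only [add_apply, map_add, h₁, h₂]
    abel
  zero_mem' a b := by simp
  smul_mem' c D hD a b := by
    have h := hD a b
    simp [h]

/-- Closedness makes the space of derivations complete, as inverting operators on it requires. -/
theorem isClosed_derivations (M : BanachBimodule 𝕜 A X) :
    IsClosed (M.derivations : Set (A →L[𝕜] X)) := by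
  have h : (M.derivations : Set (A →L[𝕜] X)) =
      ⋂ a : A, ⋂ b : A, {D | D (a * b) = M.lsmul a (D b) + M.rsmul b (D a)} := by
    ext D
    simp only [Set.mem_iInter]
    rfl
  rw [h]
  refine isClosed_iInter fun a => isClosed_iInter fun b => isClosed_eq ?_ ?_ <;> fun_prop

/-- The map sending `ξ` to the inner derivation `a ↦ a · ξ - ξ · a`. -/
noncomputable def inner (M : BanachBimodule 𝕜 A X) : X →L[𝕜] M.derivations :=
  (M.lsmul.flip - M.rsmul.flip).codRestrict M.derivations fun ξ a b => by
    simp [M.lsmul_mul, M.rsmul_mul, M.lsmul_rsmul]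

theorem inner_apply (M : BanachBimodule 𝕜 A X) (ξ : X) (a : A) :
    (M.inner ξ : A →L[𝕜] X) a = M.lsmul a ξ - M.rsmul a ξ := rfl

/-- The evaluation map `a ↦ (D ↦ D a)`, viewed below as the universal derivation. -/
noncomputable def eval (M : BanachBimodule 𝕜 A X) : A →L[𝕜] (M.derivations →L[𝕜] X) :=
  M.derivations.subtypeL.flip

theorem isDerivation_eval (M : BanachBimodule 𝕜 A X) :
    (M.hom M.derivations).IsDerivation M.eval := fun a b => by
  ext D
  exact D.2 a b

/-- An invertibility criterion: an operator at distance less than one from the identity is a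
unit. -/
theorem isUnit_of_norm_one_sub_lt {Z : Type*} [NormedAddCommGroup Z] [NormedSpace 𝕜 Z]
    [CompleteSpace Z] {S : Z →L[𝕜] Z} (h : ‖1 - S‖ < 1) : IsUnit S := by
  simpa using isUnit_one_sub_of_norm_lt_one h

/-- If a semi-inner map `a ↦ a · ξ - η · a` is close to a derivation then `a · (η - ξ) · b` is
small. -/
theorem norm_lsmul_rsmul_sub_le (M : BanachBimodule 𝕜 A X) {D : A →L[𝕜] X}
    (hD : M.IsDerivation D) {ξ η : X} {ε : ℝ} (hε : 0 ≤ ε)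
    (h : ∀ a, ‖D a - (M.lsmul a ξ - M.rsmul a η)‖ ≤ ε * ‖a‖) (a b : A) :
    ‖M.lsmul b (M.rsmul a (η - ξ))‖ ≤ ε * (1 + ‖M.lsmul‖ + ‖M.rsmul‖) * ‖a‖ * ‖b‖ := by
  set T : A → X := fun a => D a - (M.lsmul a ξ - M.rsmul a η) with hT
  -- The right side is the coboundary of `T`; the derivation `D` contributes nothing to it.
  have key : M.lsmul b (M.rsmul a (η - ξ)) =
      M.lsmul b (T a) + M.rsmul a (T b) - T (b * a) := by
    simp only [hT, hD b a, M.lsmul_mul, M.rsmul_mul, map_sub, M.lsmul_rsmul]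
    abel
  have h₁ : ‖M.lsmul b (T a)‖ ≤ ‖M.lsmul‖ * ‖b‖ * (ε * ‖a‖) :=
    (M.lsmul.le_opNorm₂ b (T a)).trans (by gcongr; exact h a)
  have h₂ : ‖M.rsmul a (T b)‖ ≤ ‖M.rsmul‖ * ‖a‖ * (ε * ‖b‖) :=
    (M.rsmul.le_opNorm₂ a (T b)).trans (by gcongr; exact h b)
  have h₃ : ‖T (b * a)‖ ≤ ε * (‖b‖ * ‖a‖) :=
    (h (b * a)).trans (by gcongr; exact norm_mul_le b a)
  rw [key]
  calc _ ≤ ‖M.lsmul b (T a)‖ + ‖M.rsmul a (T b)‖ + ‖T (b * a)‖ :=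
        (norm_sub_le _ _).trans (by gcongr; exact norm_add_le _ _)
    _ ≤ _ := by linarith

/-- Let `P` be an operator on `X` that acts like left multiplication by a right identity. If the
universal derivation is a norm limit of semi-inner maps then all derivations into `X` are inner. -/
theorem isInner_of_isNormApproxSemiInner_eval [CompleteSpace X] (M : BanachBimodule 𝕜 A X)
    (P : X →L[𝕜] X) {K : ℝ} (hK : 0 ≤ K) (hP : ∀ a x, M.lsmul a (P x) = M.lsmul a x)
    (hPK : ∀ (x : X) (a : A) (c : ℝ), 0 ≤ c → (∀ b, ‖M.lsmul b (M.rsmul a x)‖ ≤ c * ‖b‖) →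
      ‖M.rsmul a (P x)‖ ≤ K * c)
    (h : (M.hom M.derivations).IsNormApproxSemiInner M.eval) {D : A →L[𝕜] X}
    (hD : M.IsDerivation D) : M.IsInner D := by
  have : CompleteSpace M.derivations := M.isClosed_derivations.completeSpace_coe
  set L : ℝ := 1 + ‖M.lsmul‖ + ‖M.rsmul‖ with hL
  have hL0 : 0 ≤ L := by positivity
  -- Makes `ε * (1 + K * L) = 1 / 2`: approximation error plus correction by `P`.
  set ε : ℝ := 1 / (2 * (1 + K * L)) with hεdef
  have hε : 0 < ε := by positivity
  obtain ⟨T, ⟨ξ, η, hT⟩, hdist⟩ := Metric.mem_closure_iff.1 h ε hε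
  rw [dist_eq_norm] at hdist
  have happ (D : M.derivations) (a : A) :
      ‖(D : A →L[𝕜] X) a - (M.lsmul a (ξ D) - M.rsmul a (η D))‖ ≤ ε * ‖D‖ * ‖a‖ := by
    have h₁ : (D : A →L[𝕜] X) a - (M.lsmul a (ξ D) - M.rsmul a (η D)) =
        (M.eval - T) a D := by
      rw [sub_apply, sub_apply, hT a]
      rfl
    rw [h₁]
    calc _ ≤ ‖M.eval - T‖ * ‖a‖ * ‖D‖ := (M.eval - T).le_opNorm₂ a D
      _ ≤ ε * ‖a‖ * ‖D‖ := by gcongr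
      _ = _ := by ring
  -- By `hP`, `a · R D = a · ξ D`, while `R D · a` differs from `η D · a` only by the small `P (η D
  -- - ξ D) · a`.
  set R : M.derivations →L[𝕜] X := η - P.comp (η - ξ) with hR
  have hclose : ‖1 - M.inner.comp R‖ ≤ 1 / 2 := by
    refine ContinuousLinearMap.opNorm_le_bound _ (by norm_num) fun D => ?_
    refine ContinuousLinearMap.opNorm_le_bound _ (by positivity) fun a => ?_
    have h₁ : ((1 - M.inner.comp R) D : A →L[𝕜] X) a =
        ((D : A →L[𝕜] X) a - (M.lsmul a (ξ D) - M.rsmul a (η D))) -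
          M.rsmul a (P (η D - ξ D)) := by
      change (D : A →L[𝕜] X) a - (M.inner (R D) : A →L[𝕜] X) a = _
      rw [inner_apply]
      simp only [hR, sub_apply, ContinuousLinearMap.comp_apply, map_sub, hP]
      abel
    have h₂ : ‖M.rsmul a (P (η D - ξ D))‖ ≤ K * (ε * ‖D‖ * L * ‖a‖) :=
      hPK _ _ _ (by positivity) fun b =>
        M.norm_lsmul_rsmul_sub_le D.2 (by positivity) (happ D) a b
    have h₃ : ε * (1 + K * L) = 1 / 2 := by
      rw [hεdef]
      field_simp
    change ‖((1 - M.inner.comp R) D : A →L[𝕜] X) a‖ ≤ _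
    rw [h₁]
    calc _ ≤ ε * ‖D‖ * ‖a‖ + K * (ε * ‖D‖ * L * ‖a‖) :=
          (norm_sub_le _ _).trans (add_le_add (happ D a) h₂)
      _ = ε * (1 + K * L) * ‖D‖ * ‖a‖ := by ring
      _ = _ := by rw [h₃]
  obtain ⟨u, hu⟩ := isUnit_of_norm_one_sub_lt (hclose.trans_lt (by norm_num))
  refine ⟨R ((↑u⁻¹ : M.derivations →L[𝕜] M.derivations) ⟨D, hD⟩), fun a => ?_⟩
  rw [← inner_apply]
  have h₁ : M.inner.comp R ((↑u⁻¹ : M.derivations →L[𝕜] M.derivations) ⟨D, hD⟩) = ⟨D, hD⟩ := by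
    rw [← hu, ← mul_apply_eq_comp, u.mul_inv, one_apply_eq_self]
  exact (congrArg (fun E : M.derivations => (E : A →L[𝕜] X) a) h₁).symm

/-- The image of a norm limit of semi-inner maps under a bounded bimodule map. -/
theorem IsNormApproxSemiInner.map {M : BanachBimodule 𝕜 A X} {Y : Type*} [NormedAddCommGroup Y]
    [NormedSpace 𝕜 Y] {N : BanachBimodule 𝕜 A Y} {D : A →L[𝕜] X} (h : M.IsNormApproxSemiInner D)
    (f : X →L[𝕜] Y) (hl : ∀ a x, f (M.lsmul a x) = N.lsmul a (f x))
    (hr : ∀ a x, f (M.rsmul a x) = N.rsmul a (f x)) : N.IsNormApproxSemiInner (f.comp D) := by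
  refine map_mem_closure (f := fun D : A →L[𝕜] X => f.comp D) ?_ h ?_
  · exact (ContinuousLinearMap.compL 𝕜 A X Y f).continuous
  · rintro T ⟨ξ, η, hT⟩
    exact ⟨f ξ, f η, fun a => by simp [hT, hl, hr]⟩

/-- The canonical embedding into the bidual preserves derivations. -/
theorem IsDerivation.bidual {M : BanachBimodule 𝕜 A X} {D : A →L[𝕜] X} (hD : M.IsDerivation D) :
    M.dual.dual.IsDerivation ((NormedSpace.inclusionInDoubleDual 𝕜 X).comp D) := fun a b => by
  ext f
  change f (D (a * b)) = f (M.lsmul a (D b)) + f (M.rsmul b (D a))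
  rw [hD a b, map_add]

/-- Postcomposition of a bounded bilinear map with bounded functionals. -/
noncomputable def postcompBilinear {Z V : Type*} [NormedAddCommGroup Z] [NormedSpace 𝕜 Z]
    [NormedAddCommGroup V] [NormedSpace 𝕜 V] (B : Z →L[𝕜] X →L[𝕜] V) :
    (V →L[𝕜] 𝕜) →L[𝕜] (Z →L[𝕜] X →L[𝕜] 𝕜) :=
  ((ContinuousLinearMap.compL 𝕜 Z (X →L[𝕜] V) (X →L[𝕜] 𝕜)).flip B).comp
    (ContinuousLinearMap.compL 𝕜 X V 𝕜)

/-- The bilinear map sending `(z, x)` to the functional `T ↦ T z x`. -/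
noncomputable def evalBilinear (𝕜 X Z : Type*) [RCLike 𝕜] [NormedAddCommGroup X]
    [NormedSpace 𝕜 X] [NormedAddCommGroup Z] [NormedSpace 𝕜 Z] :
    Z →L[𝕜] X →L[𝕜] ((Z →L[𝕜] X →L[𝕜] 𝕜) →L[𝕜] 𝕜) :=
  ContinuousLinearMap.flip
    (((ContinuousLinearMap.compL 𝕜 (Z →L[𝕜] X →L[𝕜] 𝕜) (X →L[𝕜] 𝕜) 𝕜).flip.comp
      (ContinuousLinearMap.id 𝕜 (Z →L[𝕜] X →L[𝕜] 𝕜)).flip).flip.comp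
        (ContinuousLinearMap.id 𝕜 (X →L[𝕜] 𝕜)).flip)

/-- The canonical projection from the bidual of the operators `Z → X*` onto these operators. -/
noncomputable def bidualProj (𝕜 X Z : Type*) [RCLike 𝕜] [NormedAddCommGroup X] [NormedSpace 𝕜 X]
    [NormedAddCommGroup Z] [NormedSpace 𝕜 Z] :
    (((Z →L[𝕜] X →L[𝕜] 𝕜) →L[𝕜] 𝕜) →L[𝕜] 𝕜) →L[𝕜] (Z →L[𝕜] X →L[𝕜] 𝕜) :=
  postcompBilinear (evalBilinear 𝕜 X Z)

end

end BanachBimodule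

/-! ### Right identities and the two implications -/

section

variable {𝕜 : Type} {A : Type u} [RCLike 𝕜] [NonUnitalNormedRing A] [NormedSpace 𝕜 A]

theorem IsUniformlyApproxSemiAmenable.isNormApproxSemiInner_hom_dual
    (h : IsUniformlyApproxSemiAmenable 𝕜 A) {X Z : Type u} [NormedAddCommGroup X]
    [NormedSpace 𝕜 X] [NormedAddCommGroup Z] [NormedSpace 𝕜 Z] (M : BanachBimodule 𝕜 A X)
    {D : A →L[𝕜] (Z →L[𝕜] X →L[𝕜] 𝕜)} (hD : (M.dual.hom Z).IsDerivation D) :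
    (M.dual.hom Z).IsNormApproxSemiInner D := by
  have h₁ := (h _ (M.dual.hom Z).dual _ hD.bidual).map (N := M.dual.hom Z)
    (BanachBimodule.bidualProj 𝕜 X Z) (fun _ _ => rfl) (fun _ _ => rfl)
  -- The projection undoes the canonical embedding definitionally.
  exact h₁

variable [IsScalarTower 𝕜 A A] [SMulCommClass 𝕜 A A]

/-- The bimodule `A` with the multiplication on the left and the zero action on the right. -/
noncomputable def leftBimodule (𝕜 : Type) (A : Type u) [RCLike 𝕜] [NonUnitalNormedRing A]
    [NormedSpace 𝕜 A] [IsScalarTower 𝕜 A A] [SMulCommClass 𝕜 A A] : BanachBimodule 𝕜 A A where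
  lsmul := ContinuousLinearMap.mul 𝕜 A
  rsmul := 0
  lsmul_mul a b x := mul_assoc a b x
  rsmul_mul a b x := by simp
  lsmul_rsmul a b x := by simp

theorem isDerivation_leftBimodule_id :
    (leftBimodule 𝕜 A).IsDerivation (ContinuousLinearMap.id 𝕜 A) := fun a b => by
  simp [leftBimodule]

theorem IsUniformlyApproxSemiContractible.exists_right_identity [CompleteSpace A]
    (h : IsUniformlyApproxSemiContractible 𝕜 A) : ∃ e : A, ∀ a : A, a * e = a := by
  obtain ⟨T, ⟨ξ, η, hT⟩, hdist⟩ :=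
    Metric.mem_closure_iff.1 (h A _ _ isDerivation_leftBimodule_id) 1 one_pos
  have hTξ (a : A) : T a = a * ξ := by simpa [leftBimodule] using hT a
  rw [dist_eq_norm] at hdist
  obtain ⟨u, rfl⟩ := BanachBimodule.isUnit_of_norm_one_sub_lt hdist
  have hinj (x y : A) (hxy : (u : A →L[𝕜] A) x = (u : A →L[𝕜] A) y) : x = y := by
    have h₁ (z : A) : (↑u⁻¹ : A →L[𝕜] A) ((u : A →L[𝕜] A) z) = z := by
      rw [← mul_apply_eq_comp, u.inv_mul, one_apply_eq_self]
    rw [← h₁ x, hxy, h₁]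
  -- With `u a = a * ξ` and `e = u⁻¹ ξ`: `u (a * e) = a * u e = a * ξ = u a`.
  refine ⟨(↑u⁻¹ : A →L[𝕜] A) ξ, fun a => hinj _ _ ?_⟩
  rw [hTξ, hTξ, mul_assoc, ← hTξ, ← mul_apply_eq_comp, u.mul_inv,
    one_apply_eq_self]

/-- The bidual of `A` contains a virtual right identity. -/
theorem IsUniformlyApproxSemiAmenable.exists_bidual_right_identity
    (h : IsUniformlyApproxSemiAmenable 𝕜 A) :
    ∃ E : (A →L[𝕜] 𝕜) →L[𝕜] 𝕜, ∀ (φ : A →L[𝕜] 𝕜) (a : A),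
      E (φ.comp (ContinuousLinearMap.mul 𝕜 A a)) = φ a := by
  obtain ⟨T, ⟨ξ, η, hT⟩, hdist⟩ :=
    Metric.mem_closure_iff.1 (h _ (leftBimodule 𝕜 A).dual _
      (isDerivation_leftBimodule_id (𝕜 := 𝕜) (A := A)).bidual) 1 one_pos
  have hTξ (a : A) (φ : A →L[𝕜] 𝕜) : T a φ = ξ (φ.comp (ContinuousLinearMap.mul 𝕜 A a)) := by
    have h₁ : (leftBimodule 𝕜 A).dual.dual.rsmul a η = 0 := by
      ext f
      change η (f.comp (0 : A →L[𝕜] A)) = 0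
      simp
    rw [hT a, h₁, sub_zero]
    rfl
  rw [dist_eq_norm] at hdist
  -- Transposing turns the embedding `A → A**` into the identity of `A*`, so `T.flip` is invertible.
  have hS : ‖1 - T.flip‖ < 1 := by
    rw [← ContinuousLinearMap.opNorm_flip] at hdist
    exact hdist
  obtain ⟨u, hu⟩ := BanachBimodule.isUnit_of_norm_one_sub_lt hS
  have hright (φ : A →L[𝕜] 𝕜) : T.flip ((↑u⁻¹ : (A →L[𝕜] 𝕜) →L[𝕜] (A →L[𝕜] 𝕜)) φ) = φ := by
    rw [← hu, ← mul_apply_eq_comp, u.mul_inv, one_apply_eq_self]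
  have hleft (φ : A →L[𝕜] 𝕜) : (↑u⁻¹ : (A →L[𝕜] 𝕜) →L[𝕜] (A →L[𝕜] 𝕜)) (T.flip φ) = φ := by
    rw [← hu, ← mul_apply_eq_comp, u.inv_mul, one_apply_eq_self]
  have hcomm (φ : A →L[𝕜] 𝕜) (a : A) :
      T.flip (φ.comp (ContinuousLinearMap.mul 𝕜 A a)) =
        (T.flip φ).comp (ContinuousLinearMap.mul 𝕜 A a) := by
    ext b
    change T b _ = T (a * b) φ
    rw [hTξ, hTξ]
    congr 1
    ext c
    simp [mul_assoc]
  refine ⟨ξ.comp (↑u⁻¹ : (A →L[𝕜] 𝕜) →L[𝕜] (A →L[𝕜] 𝕜)), fun φ a => ?_⟩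
  set ψ := (↑u⁻¹ : (A →L[𝕜] 𝕜) →L[𝕜] (A →L[𝕜] 𝕜)) φ with hψ
  rw [ContinuousLinearMap.comp_apply, ← hright φ, ← hψ, ← hcomm, hleft, ← hTξ]
  rfl

theorem IsUniformlyApproxSemiContractible.isContractibleBanachAlgebra [CompleteSpace A]
    (h : IsUniformlyApproxSemiContractible 𝕜 A) : IsContractibleBanachAlgebra 𝕜 A := by
  intro X _ _ _ M D hD
  obtain ⟨e, he⟩ := h.exists_right_identity
  refine M.isInner_of_isNormApproxSemiInner_eval (M.lsmul e) (norm_nonneg e)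
    (fun a x => by rw [← M.lsmul_mul, he]) (fun x a c _ hx => ?_)
    (h _ (M.hom M.derivations) _ M.isDerivation_eval) hD
  -- The bound needed is the case `b = e` of `hx`.
  rw [M.lsmul_rsmul, mul_comm]
  exact hx e

theorem IsUniformlyApproxSemiAmenable.isAmenableBanachAlgebra
    (h : IsUniformlyApproxSemiAmenable 𝕜 A) : IsAmenableBanachAlgebra 𝕜 A := by
  intro X _ _ _ M D hD
  obtain ⟨E, hE⟩ := h.exists_bidual_right_identity
  -- The action of `E` on `X*`: `P f x` is `E` applied to `b ↦ f (x · b)`.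
  set P : (X →L[𝕜] 𝕜) →L[𝕜] (X →L[𝕜] 𝕜) :=
    (ContinuousLinearMap.compL 𝕜 X (A →L[𝕜] 𝕜) 𝕜 E).comp
      (((ContinuousLinearMap.compL 𝕜 X (A →L[𝕜] X) (A →L[𝕜] 𝕜)).flip M.rsmul.flip).comp
        (ContinuousLinearMap.compL 𝕜 A X 𝕜))
  have hPapply (f : X →L[𝕜] 𝕜) (x : X) : P f x = E (f.comp (M.rsmul.flip x)) := rfl
  refine M.dual.isInner_of_isNormApproxSemiInner_eval P (norm_nonneg E) (fun a f => ?_)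
    (fun f a c hc hf => ?_) (h.isNormApproxSemiInner_hom_dual M M.dual.isDerivation_eval) hD
  · ext x
    rw [M.dual_lsmul_apply, M.dual_lsmul_apply, hPapply]
    have h₁ : f.comp (M.rsmul.flip (M.rsmul a x)) =
        (f.comp (M.rsmul.flip x)).comp (ContinuousLinearMap.mul 𝕜 A a) := by
      ext b
      simp [M.rsmul_mul]
    rw [h₁, hE]
    rfl
  · refine ContinuousLinearMap.opNorm_le_bound _ (by positivity) fun x => ?_
    rw [M.dual_rsmul_apply, hPapply, mul_assoc]
    refine E.le_opNorm_of_le (ContinuousLinearMap.opNorm_le_bound _ (by positivity) fun b => ?_)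
    have h₁ : f.comp (M.rsmul.flip (M.lsmul a x)) b = M.dual.lsmul b (M.dual.rsmul a f) x := by
      simp [M.dual_lsmul_apply, M.dual_rsmul_apply, M.lsmul_rsmul]
    rw [h₁]
    calc _ ≤ c * ‖b‖ * ‖x‖ := ContinuousLinearMap.le_of_opNorm_le _ (hf b) x
      _ = _ := by ring

end

theorem mainTheorem8 {𝕜 : Type} [RCLike 𝕜] {A : Type u} [NonUnitalNormedRing A] [NormedSpace 𝕜 A]
    [IsScalarTower 𝕜 A A] [SMulCommClass 𝕜 A A] [CompleteSpace A] :
    (IsUniformlyApproxSemiAmenable 𝕜 A → IsAmenableBanachAlgebra 𝕜 A) ∧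
      (IsUniformlyApproxSemiContractible 𝕜 A → IsContractibleBanachAlgebra 𝕜 A) :=
  ⟨fun h => h.isAmenableBanachAlgebra, fun h => h.isContractibleBanachAlgebra⟩
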